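/- For integers $2\le k\le n$, let $\mathcal S^n_+$ be the cone of real symmetric positive semidefinite (PSD) $n\times n$ matrices, and let $\mathcal S^{n,k}$ (the $k$-PSD closure) be the set of all real symmetric $n\times n$ matrices all of whose $k\times k$ principal submatrices are PSD. With $\|\cdot\|_F$ the Frobenius norm, put $$\overline{\mathrm{dist}}_F(\mathcal S^{n,k},\mathcal S^n_+)=\sup_{M\in\mathcal S^{n,k},\ \|M\|_F=1}\ \inf_{N\in\mathcal S^n_+}\|M-N\|_F .$$ Fix a constant $r<\frac1{93}$. Then for all integers $n$ and $k$ with $k=rn$ and $k\ge 2$, $$\overline{\mathrm{dist}}_F(\mathcal S^{n,k},\mathcal S^n_+)>\frac{\sqrt{r-93r^2}}{\sqrt{162r+3}},$$ a bound which is independent of $n$. -/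

import Mathlib

/-! Matrices carry the Frobenius norm `‖M‖ = (∑ i, ∑ j, |M i j| ^ 2) ^ (1 / 2)` and its metric. -/
attribute [local instance] Matrix.frobeniusNormedAddCommGroup

/-- The cone of real symmetric positive semidefinite `n × n` matrices. -/
def psdCone (n : ℕ) : Set (Matrix (Fin n) (Fin n) ℝ) :=
  {M | M.PosSemidef}

/-- The `k`-PSD closure: the real symmetric `n × n` matrices all of whose `k × k` principal
submatrices are positive semidefinite. -/
def kPSDClosure (n k : ℕ) : Set (Matrix (Fin n) (Fin n) ℝ) :=
  {M | M.IsSymm ∧ ∀ J : Finset (Fin n), J.card = k →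
    (M.submatrix (fun i : J => (i : Fin n)) (fun i : J => (i : Fin n))).PosSemidef}

/-- The Frobenius distance from `M` to the PSD cone: the infimum of `‖M - N‖` over the
positive semidefinite matrices `N`. -/
noncomputable def distPSD {n : ℕ} (M : Matrix (Fin n) (Fin n) ℝ) : ℝ :=
  ⨅ N : psdCone n, ‖M - (N : Matrix (Fin n) (Fin n) ℝ)‖

/-- The normalized Frobenius distance between the `k`-PSD closure and the PSD cone: the supremum
of the distance to the PSD cone over the matrices of unit Frobenius norm in the `k`-PSD closure. -/
noncomputable def normalizedDist (n k : ℕ) : ℝ :=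
  sSup {d : ℝ | ∃ M ∈ kPSDClosure n k, ‖M‖ = 1 ∧ d = distPSD M}

/-- The distance to the PSD cone is at most the norm, since the zero matrix is PSD. -/
theorem distPSD_le_norm {n : ℕ} (M : Matrix (Fin n) (Fin n) ℝ) : distPSD M ≤ ‖M‖ := by
  have h0 : (0 : Matrix (Fin n) (Fin n) ℝ) ∈ psdCone n := Matrix.PosSemidef.zero
  have hb : BddBelow (Set.range fun N : psdCone n => ‖M - (N : Matrix (Fin n) (Fin n) ℝ)‖) :=
    ⟨0, by rintro _ ⟨N, rfl⟩; exact norm_nonneg _⟩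
  simpa [distPSD] using ciInf_le hb ⟨0, h0⟩

/-- The supremum in `normalizedDist` is over a bounded set. -/
theorem bddAbove_normalizedDist (n k : ℕ) :
    BddAbove {d : ℝ | ∃ M ∈ kPSDClosure n k, ‖M‖ = 1 ∧ d = distPSD M} :=
  ⟨1, by rintro _ ⟨M, -, hM, rfl⟩; exact hM ▸ distPSD_le_norm M⟩

open Finset

/-! The bound never exceeds `√(1 / 1116)`, so it suffices to beat this constant whenever `93 * k ≤
n`. Take `93 * k` sign vectors in dimension `k`, padded by zero vectors, with Gram matrix `G`, such
that any `k` of them have synthesis operator of squared norm at most `72 * k`. Then `M = 72 k D -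
G`, with `D` the projection on the support, lies in the `k`-PSD closure. Yet `G` has rank at most
`k` and trace `93 k²`, so `‖G‖² ≥ 8649 k³` exceeds `72 k · tr G = 6696 k³`. Hence `⟨M, G⟩ < 0`, and
pairing with `G` separates `M` from the PSD cone.

The sign vectors exist by averaging: an exponential moment bound on a lattice net of at most `48 ^
k` points handles all `k`-subsets at once (`exists_signs_sum_sq_le`), and rounding passes from the
net to the operator norm (`norm_le_of_latticeNet`). -/

/-! ### Exponential square moments of Rademacher sums. -/

theorem exp_sq_add_exp_sq_le (l a w : ℝ) :
    Real.exp (l * (a + w) ^ 2) + Real.exp (l * (a - w) ^ 2) ≤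
      2 * Real.exp (l * (1 + 2 * l * w ^ 2) * a ^ 2 + l * w ^ 2) := by
  have h1 : Real.exp (l * (a + w) ^ 2) + Real.exp (l * (a - w) ^ 2) =
      2 * (Real.exp (l * a ^ 2 + l * w ^ 2) * Real.cosh (2 * l * a * w)) := by
    rw [Real.cosh_eq]
    have e1 : l * (a + w) ^ 2 = (l * a ^ 2 + l * w ^ 2) + 2 * l * a * w := by ring
    have e2 : l * (a - w) ^ 2 = (l * a ^ 2 + l * w ^ 2) + -(2 * l * a * w) := by ring
    rw [e1, e2, Real.exp_add, Real.exp_add _ (-(2 * l * a * w))]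
    ring
  rw [h1]
  have h2 := Real.cosh_le_exp_half_sq (2 * l * a * w)
  calc _ ≤ 2 * (Real.exp (l * a ^ 2 + l * w ^ 2) * Real.exp ((2 * l * a * w) ^ 2 / 2)) := by gcongr
    _ = _ := by rw [← Real.exp_add]; congr 2; ring

/-- The sign `±1` encoded by a Boolean. -/
def boolSign (b : Bool) : ℝ := if b then 1 else -1

theorem boolSign_mul_self (b : Bool) : boolSign b * boolSign b = 1 := by
  cases b <;> norm_num [boolSign]

/-- The exponential square moment of a shifted Rademacher sum. -/
theorem sum_exp_sq_rademacher_le (m : ℕ) : ∀ (w : Fin m → ℝ) (l a : ℝ), 0 ≤ l →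
    2 * l * ∑ i, w i ^ 2 < 1 →
    ∑ ε : Fin m → Bool, Real.exp (l * (a + ∑ i, boolSign (ε i) * w i) ^ 2) ≤
      2 ^ m * Real.exp (l / (1 - 2 * l * ∑ i, w i ^ 2) * (a ^ 2 + ∑ i, w i ^ 2)) := by
  induction m with
  | zero => intro w l a hl h; simp
  | succ m ih =>
    intro w l a hl h
    rw [← (Fin.consEquiv fun _ => Bool).sum_comp, Fintype.sum_prod_type]
    simp only [Fin.consEquiv_apply, Fin.sum_univ_succ, Fin.cons_zero, Fin.cons_succ,
      Fintype.sum_bool] at h ⊢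
    set V := ∑ i : Fin m, w i.succ ^ 2 with hV
    set c := w 0 with hc
    have hV0 : 0 ≤ V := Finset.sum_nonneg fun i _ => sq_nonneg _
    have hd : 0 < 1 - 2 * l * (c ^ 2 + V) := by linarith
    have hlc : 0 ≤ l * c ^ 2 := by positivity
    have hd' : 0 < 1 - 2 * l * V := by nlinarith
    have i1 := ih (fun i => w i.succ) l (a + c) hl (by linarith)
    have i2 := ih (fun i => w i.succ) l (a - c) hl (by linarith)
    rw [← hV] at i1 i2
    set L := l / (1 - 2 * l * V) with hL
    have hL0 : 0 ≤ L := by positivity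
    set K := l / (1 - 2 * l * (c ^ 2 + V)) with hK
    -- Since `1/K = 1/L - 2c²`, this is `(1 + x)(1 - x) ≤ 1` with `x = 2Lc²`.
    have hLK : L * (1 + 2 * L * c ^ 2) ≤ K := by
      rw [hL, hK, le_div_iff₀ hd]
      have hdd : 1 - 2 * l * (c ^ 2 + V) = (1 - 2 * l * V) - 2 * l * c ^ 2 := by ring
      rw [hdd]
      generalize 1 - 2 * l * V = d at hd'
      have : l / d * (1 + 2 * (l / d) * c ^ 2) * (d - 2 * l * c ^ 2) =
          l - 4 * l * (l * c ^ 2) ^ 2 / d ^ 2 := by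
        field_simp
        ring
      rw [this]
      have : 0 ≤ 4 * l * (l * c ^ 2) ^ 2 / d ^ 2 := by positivity
      linarith
    have hLK' : L ≤ K := le_trans (by nlinarith [mul_nonneg hL0 (mul_nonneg hL0 (sq_nonneg c))]) hLK
    have s1 : ∀ ε : Fin m → Bool, a + (boolSign true * c + ∑ i, boolSign (ε i) * w i.succ) =
        a + c + ∑ i, boolSign (ε i) * w i.succ := fun ε => by simp [boolSign]; ring
    have s2 : ∀ ε : Fin m → Bool, a + (boolSign false * c + ∑ i, boolSign (ε i) * w i.succ) =
        a - c + ∑ i, boolSign (ε i) * w i.succ := fun ε => by simp [boolSign]; ring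
    simp only [s1, s2]
    refine (add_le_add i1 i2).trans ?_
    rw [mul_add, mul_add, Real.exp_add, Real.exp_add, ← mul_add, ← add_mul]
    calc 2 ^ m * ((Real.exp (L * (a + c) ^ 2) + Real.exp (L * (a - c) ^ 2)) * Real.exp (L * V))
        ≤ 2 ^ m * ((2 * Real.exp (L * (1 + 2 * L * c ^ 2) * a ^ 2 + L * c ^ 2)) *
            Real.exp (L * V)) := by
          gcongr
          exact exp_sq_add_exp_sq_le L a c
      _ = 2 ^ (m + 1) * Real.exp (L * (1 + 2 * L * c ^ 2) * a ^ 2 + L * (c ^ 2 + V)) := by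
          rw [pow_succ, mul_assoc, mul_assoc, ← Real.exp_add, ← mul_assoc]
          congr 2; ring
      _ ≤ 2 ^ (m + 1) * Real.exp (K * (a ^ 2 + (c ^ 2 + V))) := by
          gcongr
          rw [mul_add K]
          gcongr

/-! ### The lattice net and its cardinality. -/

/-- The integer points of the intersection of an `ℓ¹` and an `ℓ²` ball in dimension `m`. -/
noncomputable def latticeNet (m : ℕ) : Finset (Fin m → ℤ) :=
  (Fintype.piFinset fun _ => Icc (-(4 * m : ℤ)) (4 * m)).filter fun z =>
    ∑ i, (z i).natAbs ≤ 4 * m ∧ ∑ i, z i ^ 2 ≤ 16 * (m : ℤ)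

theorem sum_half_pow_natAbs_le (B : ℕ) :
    ∑ a ∈ Icc (-(B : ℤ)) B, (1 / 2 : ℝ) ^ a.natAbs ≤ 3 - 2 * (1 / 2) ^ B := by
  induction B with
  | zero => norm_num
  | succ B ih =>
    have h : Icc (-((B + 1 : ℕ) : ℤ)) ((B + 1 : ℕ) : ℤ) =
        insert (-((B + 1 : ℕ) : ℤ)) (insert (((B + 1 : ℕ) : ℤ)) (Icc (-(B : ℤ)) B)) := by
      ext x; simp only [mem_Icc, mem_insert]; omega
    rw [h, sum_insert, sum_insert]
    · have e1 : (-((B + 1 : ℕ) : ℤ)).natAbs = B + 1 := by omega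
      have e2 : (((B + 1 : ℕ) : ℤ)).natAbs = B + 1 := by omega
      rw [e1, e2, pow_succ]
      linarith
    · simp only [mem_Icc]; omega
    · simp only [mem_Icc, mem_insert]; omega

/-- The `ℓ¹` constraint makes the weight `2 ^ (4 * m) * ∏ 2 ^ (-|z i|)` at least `1` on the net; the
weight factorizes over coordinates, each summing to at most `3`. -/
theorem card_latticeNet_le (m : ℕ) : ((latticeNet m).card : ℝ) ≤ 48 ^ m := by
  have h1 : ((latticeNet m).card : ℝ) ≤
      ∑ z ∈ latticeNet m, 2 ^ (4 * m) * ∏ i, (1 / 2 : ℝ) ^ (z i).natAbs := by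
    rw [card_eq_sum_ones, Nat.cast_sum]
    refine sum_le_sum fun z hz => ?_
    rw [prod_pow_eq_pow_sum]
    have hz' := (mem_filter.1 hz).2.1
    calc ((1 : ℕ) : ℝ) = 2 ^ (4 * m) * (1 / 2) ^ (4 * m) := by
          rw [← mul_pow]; norm_num
      _ ≤ _ := by
        gcongr 2 ^ (4 * m) * ?_
        exact pow_le_pow_of_le_one (by norm_num) (by norm_num) hz'
  refine h1.trans ?_
  rw [← mul_sum]
  have h2 : ∑ z ∈ latticeNet m, ∏ i, (1 / 2 : ℝ) ^ (z i).natAbs ≤ 3 ^ m := by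
    calc _ ≤ ∑ z ∈ Fintype.piFinset fun _ : Fin m => Icc (-(4 * m : ℤ)) (4 * m),
            ∏ i, (1 / 2 : ℝ) ^ (z i).natAbs :=
          sum_le_sum_of_subset_of_nonneg (filter_subset _ _) fun _ _ _ => by positivity
      _ = ∏ _i : Fin m, ∑ a ∈ Icc (-(4 * m : ℤ)) (4 * m), (1 / 2 : ℝ) ^ a.natAbs := by
          rw [prod_univ_sum]
      _ ≤ 3 ^ m := by
          rw [prod_const, card_univ, Fintype.card_fin]
          refine pow_le_pow_left₀ (sum_nonneg fun _ _ => by positivity) ?_ m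
          have := sum_half_pow_natAbs_le (4 * m)
          push_cast at this
          have h : (0 : ℝ) ≤ 2 * (1 / 2) ^ (4 * m) := by positivity
          linarith
  calc (2 : ℝ) ^ (4 * m) * _ ≤ 2 ^ (4 * m) * 3 ^ m := by gcongr
    _ = 48 ^ m := by rw [pow_mul, ← mul_pow]; norm_num

/-! ### A sign matrix with small energy on the net. -/

/-- Per dimension, `48` counts the net, `93 * exp (1 / 2)` is `1 / s` for the weight `s` below, and
the remaining factor `exp 1` is the mean of the product. -/
theorem exp_numeric_bound : (48 : ℝ) * 93 * Real.exp (3 / 2) ≤ Real.exp 10 := by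
  have h : (2.7182818283 : ℝ) < Real.exp 1 := Real.exp_one_gt_d9
  have h17 : (48 * 93 : ℝ) ^ 2 ≤ Real.exp (17 / 2) ^ 2 := by
    have : Real.exp (17 / 2) ^ 2 = Real.exp 1 ^ 17 := by
      rw [← Real.exp_nat_mul, ← Real.exp_nat_mul]; norm_num
    rw [this]
    calc (48 * 93 : ℝ) ^ 2 ≤ 2.7 ^ 17 := by norm_num
      _ ≤ Real.exp 1 ^ 17 := by gcongr; linarith
  have h2 := (pow_le_pow_iff_left₀ (by norm_num) (Real.exp_pos _).le two_ne_zero).1 h17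
  calc (48 : ℝ) * 93 * Real.exp (3 / 2) ≤ Real.exp (17 / 2) * Real.exp (3 / 2) := by gcongr
    _ = Real.exp 10 := by rw [← Real.exp_add]; norm_num

/-- The pairing of a sign vector with an integer vector. -/
noncomputable def signPairing {m : ℕ} (ε : Fin m → Bool) (z : Fin m → ℤ) : ℝ :=
  ∑ i, boolSign (ε i) * (z i : ℝ)

theorem sum_exp_signPairing_sq_le {m : ℕ} (hm : 0 < m) {z : Fin m → ℤ} (hz : z ∈ latticeNet m) :
    ∑ ε : Fin m → Bool, Real.exp (1 / (64 * m) * signPairing ε z ^ 2) ≤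
      2 ^ m * Real.exp (1 / 2) := by
  have hm' : (0 : ℝ) < m := by exact_mod_cast hm
  have hV : ∑ i, (z i : ℝ) ^ 2 ≤ 16 * m := by exact_mod_cast (mem_filter.1 hz).2.2
  set V := ∑ i, (z i : ℝ) ^ 2 with hVdef
  have hV0 : 0 ≤ V := sum_nonneg fun i _ => sq_nonneg _
  have hhalf : 2 * (1 / (64 * (m : ℝ))) * V ≤ 1 / 2 := by
    rw [mul_one_div, div_mul_eq_mul_div, div_le_iff₀ (by positivity)]
    linarith
  have h := sum_exp_sq_rademacher_le m (fun i => (z i : ℝ)) (1 / (64 * m)) 0 (by positivity)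
    (by rw [← hVdef]; linarith)
  simp only [zero_add, ← hVdef] at h
  refine h.trans ?_
  gcongr
  rw [div_mul_eq_mul_div, div_le_iff₀ (by linarith)]
  linarith

/-- A sign matrix for which all `m`-subsets of columns have small energy on the lattice net. -/
theorem exists_signs_sum_sq_le {ι : Type*} [Fintype ι] [DecidableEq ι] {m : ℕ} (hm : 0 < m)
    (hι : Fintype.card ι = 93 * m) :
    ∃ ε : ι → Fin m → Bool, ∀ z ∈ latticeNet m, ∀ J : Finset ι, J.card ≤ m →
      ∑ j ∈ J, signPairing (ε j) z ^ 2 ≤ 640 * (m : ℝ) ^ 2 := by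
  have hm' : (0 : ℝ) < m := by exact_mod_cast hm
  -- Chosen so that each factor `g` has mean at most `1 + 1 / 93`, hence the product of `93 * m`
  -- factors has mean at most `exp m`.
  set s : ℝ := (93 * Real.exp (1 / 2))⁻¹ with hs
  have hs0 : 0 < s := by positivity
  have hs1 : s ≤ 1 := by
    refine inv_le_one_of_one_le₀ ?_
    have := Real.one_le_exp (show (0 : ℝ) ≤ 1 / 2 by norm_num)
    linarith
  have hsb : s * Real.exp (1 / 2) = 1 / 93 := by
    rw [hs]; field_simp
  -- The summand `1` makes the full product dominate each subproduct over `J`, replacing a union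
  -- bound over subsets.
  set g : (Fin m → ℤ) → (Fin m → Bool) → ℝ :=
    fun z ε => 1 + s * Real.exp (1 / (64 * m) * signPairing ε z ^ 2) with hg
  have hg1 : ∀ z ε, 1 ≤ g z ε := fun z ε => by
    have : 0 < s * Real.exp (1 / (64 * m) * signPairing ε z ^ 2) := by positivity
    simp only [hg]; linarith
  have hgsum : ∀ z ∈ latticeNet m, ∑ ε, g z ε ≤ 2 ^ m * Real.exp (1 / 93) := fun z hz => by
    have h1 := sum_exp_signPairing_sq_le hm hz
    have h2 : ∑ ε, g z ε =
        2 ^ m + s * ∑ ε : Fin m → Bool, Real.exp (1 / (64 * m) * signPairing ε z ^ 2) := by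
      simp only [hg, sum_add_distrib, ← mul_sum]
      simp
    rw [h2]
    have h3 := Real.add_one_le_exp (1 / 93 : ℝ)
    have h4 := mul_le_mul_of_nonneg_left h1 hs0.le
    have h5 : s * (2 ^ m * Real.exp (1 / 2)) = 2 ^ m * (1 / 93) := by rw [← hsb]; ring
    have h6 : (2 : ℝ) ^ m * (1 / 93 + 1) ≤ 2 ^ m * Real.exp (1 / 93) := by gcongr
    linarith
  have key : ∑ ε : ι → Fin m → Bool, ∑ z ∈ latticeNet m, ∏ j, g z (ε j) ≤
      ∑ _ε : ι → Fin m → Bool, 48 ^ m * Real.exp m := by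
    rw [sum_comm]
    calc ∑ z ∈ latticeNet m, ∑ ε : ι → Fin m → Bool, ∏ j, g z (ε j)
        = ∑ z ∈ latticeNet m, (∑ e, g z e) ^ (93 * m) := by
          refine sum_congr rfl fun z _ => ?_
          rw [← hι, ← card_univ, ← prod_const, prod_univ_sum, Fintype.piFinset_univ]
      _ ≤ ∑ z ∈ latticeNet m, (2 ^ m * Real.exp (1 / 93)) ^ (93 * m) := by
          refine sum_le_sum fun z hz => pow_le_pow_left₀ ?_ (hgsum z hz) _
          exact sum_nonneg fun e _ => zero_le_one.trans (hg1 z e)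
      _ = (latticeNet m).card * ((2 ^ m) ^ (93 * m) * Real.exp m) := by
          rw [sum_const, nsmul_eq_mul, mul_pow, ← Real.exp_nat_mul]
          congr 3
          push_cast; ring_nf
      _ ≤ 48 ^ m * ((2 ^ m) ^ (93 * m) * Real.exp m) := by
          gcongr
          exact card_latticeNet_le m
      _ = _ := by
          rw [sum_const, nsmul_eq_mul, card_univ, Fintype.card_fun, Fintype.card_fun, hι]
          simp
          ring
  obtain ⟨ε, -, hε⟩ := exists_le_of_sum_le univ_nonempty key
  refine ⟨ε, fun z hz J hJ => ?_⟩
  have h1 : ∏ j, g z (ε j) ≤ 48 ^ m * Real.exp m :=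
    (single_le_sum (f := fun z => ∏ j, g z (ε j))
      (fun z _ => prod_nonneg fun j _ => zero_le_one.trans (hg1 z (ε j))) hz).trans hε
  have h2 : s ^ m * Real.exp (1 / (64 * m) * ∑ j ∈ J, signPairing (ε j) z ^ 2) ≤
      ∏ j, g z (ε j) := by
    calc s ^ m * Real.exp (1 / (64 * m) * ∑ j ∈ J, signPairing (ε j) z ^ 2)
        ≤ s ^ J.card * Real.exp (1 / (64 * m) * ∑ j ∈ J, signPairing (ε j) z ^ 2) := by
          gcongr ?_ * _
          exact pow_le_pow_of_le_one hs0.le hs1 hJ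
      _ = ∏ j ∈ J, s * Real.exp (1 / (64 * m) * signPairing (ε j) z ^ 2) := by
          rw [prod_mul_distrib, prod_const, mul_sum, Real.exp_sum]
      _ ≤ ∏ j ∈ J, g z (ε j) := by
          refine prod_le_prod (fun _ _ => by positivity) fun j _ => ?_
          simp [hg]
      _ ≤ ∏ j, g z (ε j) :=
          prod_le_prod_of_subset_of_one_le (subset_univ _) (fun j _ => zero_le_one.trans (hg1 z _))
            fun j _ _ => hg1 z _
  have h3 : Real.exp (1 / (64 * m) * ∑ j ∈ J, signPairing (ε j) z ^ 2) ≤ Real.exp (10 * m) := by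
    have h4 : s ^ m * Real.exp (1 / (64 * m) * ∑ j ∈ J, signPairing (ε j) z ^ 2) ≤
        s ^ m * Real.exp (10 * m) := by
      refine (h2.trans h1).trans ?_
      have e1 : Real.exp m = Real.exp 1 ^ m := by rw [← Real.exp_nat_mul, mul_one]
      have e2 : Real.exp (10 * m) = Real.exp 10 ^ m := by rw [← Real.exp_nat_mul, mul_comm]
      rw [e1, e2, ← mul_pow, ← mul_pow]
      refine pow_le_pow_left₀ (by positivity) ?_ m
      rw [hs, inv_mul_eq_div, le_div_iff₀ (by positivity)]
      have h5 : Real.exp (3 / 2) = Real.exp 1 * Real.exp (1 / 2) := by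
        rw [← Real.exp_add]; norm_num
      have h6 := exp_numeric_bound
      rw [h5] at h6
      linarith
    exact le_of_mul_le_mul_left h4 (by positivity)
  have h4 := Real.exp_le_exp.1 h3
  rw [one_div_mul_eq_div, div_le_iff₀ (by positivity)] at h4
  linarith

/-! ### From the net to the operator norm. -/

/-- Rounding of a real number to an integer, toward zero. -/
noncomputable def truncInt (x : ℝ) : ℤ := if 0 ≤ x then ⌊x⌋ else ⌈x⌉

theorem truncInt_sq_le (x : ℝ) : (truncInt x : ℝ) ^ 2 ≤ x ^ 2 := by
  unfold truncInt
  split_ifs with h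
  · have h1 := Int.floor_le x
    have h2 : (0 : ℝ) ≤ ⌊x⌋ := by exact_mod_cast Int.floor_nonneg.2 h
    exact pow_le_pow_left₀ h2 h1 2
  · have h1 := Int.le_ceil x
    have h2 : (⌈x⌉ : ℝ) ≤ 0 := by exact_mod_cast Int.ceil_le.2 (by push_cast; linarith)
    nlinarith

theorem sub_truncInt_sq_le (x : ℝ) : (x - truncInt x) ^ 2 ≤ 1 := by
  unfold truncInt
  split_ifs with h
  · have h1 := Int.floor_le x
    have h2 := Int.lt_floor_add_one x
    nlinarith
  · have h1 := Int.le_ceil x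
    have h2 := Int.ceil_lt_add_one x
    nlinarith

/-- Rounding toward zero keeps the point in the `ℓ²` ball, and Cauchy–Schwarz then gives the `ℓ¹`
bound. -/
theorem truncInt_mem_latticeNet {m : ℕ} {w : Fin m → ℝ} (hw : ∑ i, w i ^ 2 ≤ 16 * m) :
    (fun i => truncInt (w i)) ∈ latticeNet m := by
  have h2 : ∑ i, ((truncInt (w i) : ℤ) : ℝ) ^ 2 ≤ 16 * m :=
    (sum_le_sum fun i _ => truncInt_sq_le (w i)).trans hw
  have h1 : ∑ i, (truncInt (w i)).natAbs ≤ 4 * m := by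
    have hc := sq_sum_le_card_mul_sum_sq (s := univ) (f := fun i => |((truncInt (w i) : ℤ) : ℝ)|)
    simp only [sq_abs, card_univ, Fintype.card_fin] at hc
    have h3 : (∑ i, |((truncInt (w i) : ℤ) : ℝ)|) ^ 2 ≤ (4 * m : ℝ) ^ 2 := by
      refine hc.trans ?_
      have := mul_le_mul_of_nonneg_left h2 (Nat.cast_nonneg (α := ℝ) m)
      linarith
    have h4 := abs_le_of_sq_le_sq' h3 (by positivity)
    have h5 : ((∑ i, (truncInt (w i)).natAbs : ℕ) : ℝ) = ∑ i, |((truncInt (w i) : ℤ) : ℝ)| := by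
      push_cast
      simp
    exact_mod_cast h5.trans_le h4.2
  refine mem_filter.2 ⟨Fintype.mem_piFinset.2 fun i => ?_, h1, by exact_mod_cast h2⟩
  have := (single_le_sum (f := fun i => (truncInt (w i)).natAbs) (fun _ _ => Nat.zero_le _)
    (mem_univ i)).trans h1
  simp only [mem_Icc]
  omega

/-- An operator bounded on the lattice net is bounded. -/
theorem norm_le_of_latticeNet {m : ℕ} (hm : 0 < m) {F : Type*} [NormedAddCommGroup F]
    [NormedSpace ℝ F] (L : EuclideanSpace ℝ (Fin m) →L[ℝ] F) {a : ℝ} (ha : 0 ≤ a)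
    (h : ∀ z ∈ latticeNet m, ‖L (WithLp.toLp 2 fun i => (z i : ℝ))‖ ≤ a) :
    ‖L‖ ≤ a / (3 * √m) := by
  have hm' : 0 < √(m : ℝ) := Real.sqrt_pos.2 (by exact_mod_cast hm)
  have hmm : √(m : ℝ) ^ 2 = m := Real.sq_sqrt (Nat.cast_nonneg m)
  -- Scale to norm `4√m` and round: the error has norm at most `√m`, and its contribution is
  -- absorbed on the left.
  have key : ‖L‖ ≤ (a + ‖L‖ * √m) / (4 * √m) := by
    refine L.opNorm_le_bound (by positivity) fun v => ?_
    rcases eq_or_ne v 0 with rfl | hv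
    · simp
    have hv' : 0 < ‖v‖ := norm_pos_iff.2 hv
    set w := (4 * √(m : ℝ) / ‖v‖) • v with hw
    have hwn : ‖w‖ = 4 * √m := by
      rw [hw, norm_smul, Real.norm_of_nonneg (by positivity)]
      field_simp
    have hws : ∑ i, w i ^ 2 = 16 * m := by
      rw [← EuclideanSpace.real_norm_sq_eq, hwn, mul_pow, hmm]; norm_num
    set z : EuclideanSpace ℝ (Fin m) := WithLp.toLp 2 fun i => (truncInt (w i) : ℝ) with hz
    have hLz : ‖L z‖ ≤ a := h _ (truncInt_mem_latticeNet hws.le)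
    have hwz : ‖w - z‖ ≤ √m := by
      refine abs_le_of_sq_le_sq' ?_ hm'.le |>.2
      rw [EuclideanSpace.real_norm_sq_eq, hmm]
      calc ∑ i, (w - z) i ^ 2 ≤ ∑ _i : Fin m, (1 : ℝ) :=
            sum_le_sum fun i _ => sub_truncInt_sq_le (w i)
        _ = m := by simp
    have hLw : ‖L w‖ ≤ a + ‖L‖ * √m := by
      calc ‖L w‖ = ‖L z + L (w - z)‖ := by rw [← map_add, add_sub_cancel]
        _ ≤ ‖L z‖ + ‖L (w - z)‖ := norm_add_le _ _
        _ ≤ a + ‖L‖ * √m := add_le_add hLz ((L.le_opNorm _).trans (by gcongr))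
    rw [hw, map_smul, norm_smul, Real.norm_of_nonneg (by positivity)] at hLw
    rw [div_mul_eq_mul_div, le_div_iff₀ (by positivity)]
    rw [div_mul_eq_mul_div, div_le_iff₀ hv'] at hLw
    linarith
  rw [le_div_iff₀ (by positivity)] at key ⊢
  linarith

/-- The net controls the analysis operator `v ↦ (⟨A j, v⟩)_j`; its adjoint has the same norm. The
constant is `640 / 9 ≤ 72`. -/
theorem sum_sq_transpose_le {κ : Type*} [Fintype κ] {m : ℕ} (hm : 0 < m)
    (A : κ → Fin m → ℝ)
    (h : ∀ z ∈ latticeNet m, ∑ j, (∑ i, A j i * (z i : ℝ)) ^ 2 ≤ 640 * (m : ℝ) ^ 2) (u : κ → ℝ) :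
    ∑ i, (∑ j, u j * A j i) ^ 2 ≤ 72 * m * ∑ j, u j ^ 2 := by
  have hm' : (0 : ℝ) < m := by exact_mod_cast hm
  have hmm : √(m : ℝ) ^ 2 = m := Real.sq_sqrt (Nat.cast_nonneg m)
  set L : EuclideanSpace ℝ (Fin m) →L[ℝ] EuclideanSpace ℝ κ :=
    LinearMap.toContinuousLinearMap (Matrix.toEuclideanLin (Matrix.of A)) with hL
  have hLn : ∀ v : Fin m → ℝ, ‖L (WithLp.toLp 2 v)‖ ^ 2 = ∑ j, (∑ i, A j i * v i) ^ 2 := by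
    intro v
    rw [EuclideanSpace.real_norm_sq_eq]
    rfl
  have hLb : ‖L‖ ≤ √640 * m / (3 * √m) := by
    refine norm_le_of_latticeNet hm L (by positivity) fun z hz => ?_
    refine abs_le_of_sq_le_sq' ?_ (by positivity) |>.2
    rw [hLn, mul_pow, Real.sq_sqrt (by norm_num)]
    exact h z hz
  have hLs : ‖L‖ ^ 2 ≤ 72 * (m : ℝ) := by
    calc ‖L‖ ^ 2 ≤ (√640 * m / (3 * √(m : ℝ))) ^ 2 := by gcongr
      _ = 640 / 9 * (m : ℝ) := by
        rw [div_pow, mul_pow, mul_pow, hmm, Real.sq_sqrt (by norm_num)]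
        field_simp
        norm_num
      _ ≤ 72 * (m : ℝ) := by linarith
  set p : Fin m → ℝ := fun i => ∑ j, u j * A j i with hp
  set T := ∑ i, p i ^ 2 with hT
  have hT0 : 0 ≤ T := sum_nonneg fun i _ => sq_nonneg _
  have h1 : T = ∑ j, u j * ∑ i, A j i * p i := by
    simp only [hT, mul_sum]
    rw [sum_comm]
    refine sum_congr rfl fun i _ => ?_
    rw [pow_two]
    conv_lhs => rw [hp]
    rw [sum_mul]
    exact sum_congr rfl fun j _ => by ring
  have h2 : ∑ j, (∑ i, A j i * p i) ^ 2 ≤ 72 * m * T := by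
    rw [← hLn]
    have h3 : ‖(WithLp.toLp 2 p : EuclideanSpace ℝ (Fin m))‖ ^ 2 = T :=
      EuclideanSpace.real_norm_sq_eq _
    rw [← h3]
    calc _ ≤ (‖L‖ * ‖(WithLp.toLp 2 p : EuclideanSpace ℝ (Fin m))‖) ^ 2 := by
          gcongr; exact L.le_opNorm _
      _ ≤ _ := by rw [mul_pow]; gcongr
  have h3 : T ^ 2 ≤ (∑ j, u j ^ 2) * (72 * m * T) := by
    calc T ^ 2 = (∑ j, u j * ∑ i, A j i * p i) ^ 2 := by rw [← h1]
      _ ≤ (∑ j, u j ^ 2) * ∑ j, (∑ i, A j i * p i) ^ 2 := sum_mul_sq_le_sq_mul_sq _ _ _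
      _ ≤ _ := by gcongr
  rcases hT0.eq_or_lt with h0 | h0
  · rw [← h0]; positivity
  · refine le_of_mul_le_mul_right ?_ h0
    linarith

/-- A sign matrix with `93 m` columns of length `m`, any `m` of which span an operator of squared
norm at most `72 m`. -/
theorem exists_signs_operator_bound {ι : Type*} [Fintype ι] [DecidableEq ι] {m : ℕ} (hm : 0 < m)
    (hι : Fintype.card ι = 93 * m) :
    ∃ ε : ι → Fin m → Bool, ∀ J : Finset ι, J.card ≤ m → ∀ u : ι → ℝ,
      ∑ i, (∑ j ∈ J, u j * boolSign (ε j i)) ^ 2 ≤ 72 * m * ∑ j ∈ J, u j ^ 2 := by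
  obtain ⟨ε, hε⟩ := exists_signs_sum_sq_le hm hι
  refine ⟨ε, fun J hJ u => ?_⟩
  have h := sum_sq_transpose_le hm (fun (j : J) i => boolSign (ε j i))
    (fun z hz => by
      rw [sum_coe_sort J fun j => (∑ i, boolSign (ε j i) * (z i : ℝ)) ^ 2]
      exact hε z hz J hJ) fun j => u j
  rw [sum_coe_sort J fun j => u j ^ 2] at h
  have e : ∀ i, ∑ j : J, u j * boolSign (ε j i) = ∑ j ∈ J, u j * boolSign (ε j i) :=
    fun i => sum_coe_sort J fun j => u j * boolSign (ε j i)
  simpa only [e] using h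

/-! ### Frobenius duality and membership in the closure. -/

theorem frobenius_norm_sq {n : ℕ} (M : Matrix (Fin n) (Fin n) ℝ) :
    ‖M‖ ^ 2 = ∑ i, ∑ j, M i j ^ 2 := by
  rw [Matrix.frobenius_norm_def, ← Real.sqrt_eq_rpow, Real.sq_sqrt]
  · simp
  · positivity

theorem sum_mul_le_frobenius {n : ℕ} (M N : Matrix (Fin n) (Fin n) ℝ) :
    ∑ i, ∑ j, M i j * N i j ≤ ‖M‖ * ‖N‖ := by
  refine abs_le_of_sq_le_sq' ?_ (by positivity) |>.2
  rw [mul_pow, frobenius_norm_sq, frobenius_norm_sq]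
  simp only [← Fintype.sum_prod_type']
  exact sum_mul_sq_le_sq_mul_sq univ (fun p : Fin n × Fin n => M p.1 p.2) fun p => N p.1 p.2

/-- The Gram matrix of a family of vectors. -/
def gramOf {n m : ℕ} (X : Fin n → Fin m → ℝ) : Matrix (Fin n) (Fin n) ℝ :=
  Matrix.of fun i j => ∑ a, X i a * X j a

theorem sum_mul_gramOf_nonneg {n m : ℕ} {N : Matrix (Fin n) (Fin n) ℝ} (hN : N.PosSemidef)
    (X : Fin n → Fin m → ℝ) : 0 ≤ ∑ i, ∑ j, N i j * gramOf X i j := by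
  have h : ∑ i, ∑ j, N i j * gramOf X i j = ∑ a, ∑ i, ∑ j, X i a * N i j * X j a := by
    simp only [gramOf, Matrix.of_apply, mul_sum]
    rw [sum_comm' (t' := univ) (s' := fun _ => univ) (by simp)]
    rw [sum_comm]
    simp only [sum_comm (s := (univ : Finset (Fin m)))]
    exact sum_congr rfl fun i _ => sum_congr rfl fun j _ => sum_congr rfl fun a _ => by ring
  rw [h]
  refine sum_nonneg fun a _ => ?_
  have := hN.dotProduct_mulVec_nonneg fun i => X i a
  simpa [dotProduct, Matrix.mulVec, mul_sum, mul_assoc] using this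

/-- For PSD `N`, `⟨N, G⟩ ≥ 0`, so `-⟨M, G⟩ ≤ ⟨N - M, G⟩`; conclude by Cauchy–Schwarz. -/
theorem neg_sum_mul_gramOf_le {n m : ℕ} (M : Matrix (Fin n) (Fin n) ℝ) (X : Fin n → Fin m → ℝ)
    (hX : 0 < ‖gramOf X‖) : -(∑ i, ∑ j, M i j * gramOf X i j) / ‖gramOf X‖ ≤ distPSD M := by
  have : Nonempty (psdCone n) := ⟨⟨0, Matrix.PosSemidef.zero⟩⟩
  refine le_ciInf fun N => ?_
  rw [div_le_iff₀ hX, ← norm_sub_rev]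
  refine le_trans ?_ (sum_mul_le_frobenius _ _)
  have h := sum_mul_gramOf_nonneg N.2 X
  simp only [Matrix.sub_apply, sub_mul, sum_sub_distrib]
  linarith

theorem smul_mem_kPSDClosure {n k : ℕ} {M : Matrix (Fin n) (Fin n) ℝ} (hM : M ∈ kPSDClosure n k)
    {c : ℝ} (hc : 0 ≤ c) : c • M ∈ kPSDClosure n k :=
  ⟨hM.1.smul c, fun J hJ => (hM.2 J hJ).smul hc⟩

/-- A lower bound for the normalized distance from a matrix of the `k`-PSD closure and a
positive semidefinite test matrix. -/
theorem div_le_normalizedDist {n k m : ℕ} {M : Matrix (Fin n) (Fin n) ℝ}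
    (hM : M ∈ kPSDClosure n k) (hM0 : 0 < ‖M‖) (X : Fin n → Fin m → ℝ) (hX : 0 < ‖gramOf X‖) :
    -(∑ i, ∑ j, M i j * gramOf X i j) / (‖M‖ * ‖gramOf X‖) ≤ normalizedDist n k := by
  have hn : ‖‖M‖⁻¹ • M‖ = 1 := by
    have h : ‖‖M‖⁻¹ • M‖ ^ 2 = 1 := by
      rw [frobenius_norm_sq]
      simp only [Matrix.smul_apply, smul_eq_mul, mul_pow, ← mul_sum]
      rw [← frobenius_norm_sq]
      field_simp
    exact (pow_eq_one_iff_of_nonneg (norm_nonneg _) two_ne_zero).1 h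
  refine le_trans ?_ (le_csSup (bddAbove_normalizedDist n k)
    ⟨‖M‖⁻¹ • M, smul_mem_kPSDClosure hM (by positivity), hn, rfl⟩)
  refine le_trans (le_of_eq ?_) (neg_sum_mul_gramOf_le _ X hX)
  simp only [Matrix.smul_apply, smul_eq_mul, mul_assoc, ← mul_sum]
  field_simp

/-- A scaled coordinate projection minus a Gram matrix lies in the `k`-PSD closure as soon as all
subfamilies of size `k` have a bounded synthesis operator. -/
theorem diagonal_sub_gramOf_mem_kPSDClosure {n m k : ℕ} {C : ℝ} (d : Fin n → ℝ)
    (X : Fin n → Fin m → ℝ)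
    (h : ∀ J : Finset (Fin n), J.card = k → ∀ u : Fin n → ℝ,
      ∑ a, (∑ j ∈ J, u j * X j a) ^ 2 ≤ C * ∑ j ∈ J, d j * u j ^ 2) :
    C • Matrix.diagonal d - gramOf X ∈ kPSDClosure n k := by
  have hs : (C • Matrix.diagonal d - gramOf X).IsSymm := by
    ext i j
    simp only [Matrix.transpose_apply, Matrix.sub_apply, Matrix.smul_apply, gramOf,
      Matrix.of_apply, mul_comm, Matrix.diagonal_apply]
    congr 2
    by_cases hij : i = j
    · subst hij; rfl
    · rw [if_neg hij, if_neg (Ne.symm hij)]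
  refine ⟨hs, fun J hJ => Matrix.PosSemidef.of_dotProduct_mulVec_nonneg ?_ fun x => ?_⟩
  · exact (Matrix.isHermitian_iff_isSymm.2 hs).submatrix _
  · set u : Fin n → ℝ := fun i => if hi : i ∈ J then x ⟨i, hi⟩ else 0 with hu
    have hux : ∀ j : J, x j = u j := fun j => by simp [hu]
    have key := h J hJ u
    have e1 : ∀ f : Fin n → ℝ, ∑ j : J, f j = ∑ j ∈ J, f j := fun f => sum_coe_sort J f
    have e1 : ∀ f : Fin n → ℝ, ∑ j : J, f j = ∑ j ∈ J, f j := fun f => sum_coe_sort J f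
    have quad : ∀ N : Matrix (Fin n) (Fin n) ℝ, star x ⬝ᵥ (N.submatrix (fun i : J => (i : Fin n))
        (fun i : J => (i : Fin n))).mulVec x = ∑ i ∈ J, ∑ j ∈ J, u i * (N i j * u j) := by
      intro N
      rw [← e1 fun i => ∑ j ∈ J, u i * (N i j * u j)]
      simp only [dotProduct, Matrix.mulVec, star_trivial, hux, Matrix.submatrix_apply, mul_sum]
      exact sum_congr rfl fun i _ => e1 fun j => u i * (N i j * u j)
    have h1 : ∑ i ∈ J, ∑ j ∈ J, u i * ((C • Matrix.diagonal d - gramOf X) i j * u j) =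
        C * ∑ j ∈ J, d j * u j ^ 2 - ∑ a, (∑ j ∈ J, u j * X j a) ^ 2 := by
      simp only [Matrix.sub_apply, Matrix.smul_apply, smul_eq_mul, sub_mul, sum_sub_distrib,
        mul_sub]
      congr 1
      · rw [mul_sum]
        refine sum_congr rfl fun i hi => ?_
        rw [sum_eq_single_of_mem i hi fun j _ hj => by simp [Matrix.diagonal_apply_ne' _ hj]]
        simp
        ring
      · simp only [gramOf, Matrix.of_apply, pow_two, sum_mul_sum]
        symm
        rw [sum_comm]
        refine sum_congr rfl fun i _ => ?_
        rw [sum_comm]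
        refine sum_congr rfl fun j _ => ?_
        rw [sum_mul, mul_sum]
        exact sum_congr rfl fun a _ => by ring
    rw [quad]
    rw [h1]
    linarith

/-- `XXᵀ` and the `m × m` matrix `XᵀX` share trace and Frobenius norm; apply Cauchy–Schwarz to the
diagonal of the latter. -/
theorem sq_sum_le_card_mul_gramOf {n m : ℕ} (X : Fin n → Fin m → ℝ) :
    (∑ i, gramOf X i i) ^ 2 ≤ m * ‖gramOf X‖ ^ 2 := by
  have h1 : ‖gramOf X‖ ^ 2 = ∑ a, ∑ b, (∑ i, X i a * X i b) ^ 2 := by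
    rw [frobenius_norm_sq]
    simp only [gramOf, Matrix.of_apply, pow_two, sum_mul_sum]
    have e : ∀ f : Fin n → Fin n → Fin m → Fin m → ℝ,
        ∑ i, ∑ j, ∑ a, ∑ b, f i j a b = ∑ a, ∑ b, ∑ i, ∑ j, f i j a b := fun f => by
      have := sum_comm (s := univ) (t := univ)
        (f := fun (p : Fin n × Fin n) (q : Fin m × Fin m) => f p.1 p.2 q.1 q.2)
      simpa only [Fintype.sum_prod_type] using this
    rw [e]
    refine sum_congr rfl fun a _ => sum_congr rfl fun b _ => sum_congr rfl fun i _ =>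
      sum_congr rfl fun j _ => by ring
  have h2 : ∑ i, gramOf X i i = ∑ a, ∑ i, X i a * X i a := by
    simp only [gramOf, Matrix.of_apply]
    rw [sum_comm]
  rw [h1, h2]
  refine (sq_sum_le_card_mul_sum_sq (s := univ) (f := fun a => ∑ i, X i a * X i a)).trans ?_
  rw [card_univ, Fintype.card_fin]
  gcongr with a _
  exact single_le_sum (f := fun b => (∑ i, X i a * X i b) ^ 2) (fun _ _ => sq_nonneg _)
    (mem_univ a)

/-! ### The separating matrix and the final estimate. -/

/-- Vectors with entries `±1` on a set of `93 k` indices and `0` elsewhere, any `k` of which have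
a bounded synthesis operator. -/
theorem exists_padded_signs {n k : ℕ} (hk : 0 < k) (hkn : 93 * k ≤ n) :
    ∃ (I : Finset (Fin n)) (X : Fin n → Fin k → ℝ), I.card = 93 * k ∧
      (∀ i ∈ I, ∀ a, X i a ^ 2 = 1) ∧ (∀ i ∉ I, ∀ a, X i a = 0) ∧
      ∀ J : Finset (Fin n), J.card = k → ∀ u : Fin n → ℝ,
        ∑ a, (∑ j ∈ J, u j * X j a) ^ 2 ≤
          72 * k * ∑ j ∈ J, (if j ∈ I then (1 : ℝ) else 0) * u j ^ 2 := by
  obtain ⟨I, -, hI⟩ := exists_subset_card_eq (s := (univ : Finset (Fin n))) (n := 93 * k)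
    (by simpa using hkn)
  obtain ⟨ε, hε⟩ := exists_signs_operator_bound (ι := I) hk (by simpa using hI)
  refine ⟨I, fun i a => if hi : i ∈ I then boolSign (ε ⟨i, hi⟩ a) else 0, hI, ?_, ?_, ?_⟩
  · intro i hi a
    simp [hi, pow_two, boolSign_mul_self]
  · intro i hi a
    simp [hi]
  · intro J hJ u
    -- `J` may meet `I` in fewer than `k` indices, hence `≤` in the sign matrix bound.
    have h := hε (J.subtype (· ∈ I)) (by
      rw [card_subtype, ← hJ]; exact card_filter_le _ _) fun j => u j
    have e : ∀ f : Fin n → ℝ, (∀ j ∉ I, f j = 0) →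
        ∑ j ∈ J.subtype (· ∈ I), f j = ∑ j ∈ J, f j := fun f hf => by
      rw [sum_subtype_eq_sum_filter, sum_filter_of_ne]
      intro j _ hj
      by_contra hjI
      exact hj (hf j hjI)
    have e1 := e (fun j => (if j ∈ I then (1 : ℝ) else 0) * u j ^ 2) (fun j hj => by simp [hj])
    rw [← e1]
    have e2 : ∀ a, ∑ j ∈ J, u j * (if hi : j ∈ I then boolSign (ε ⟨j, hi⟩ a) else 0) =
        ∑ j ∈ J.subtype (· ∈ I), u j * boolSign (ε j a) := fun a => by
      rw [← e _ (fun j hj => by simp [hj])]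
      exact sum_congr rfl fun j _ => by simp
    simp only [e2]
    refine h.trans (le_of_eq ?_)
    congr 1
    exact sum_congr rfl fun j _ => by simp

theorem sqrt_le_normalizedDist {n k : ℕ} (hk : 0 < k) (hkn : 93 * k ≤ n) :
    √(1 / 1116) ≤ normalizedDist n k := by
  obtain ⟨I, X, hI, hX1, hX0, hJ⟩ := exists_padded_signs hk hkn
  have hk' : (0 : ℝ) < k := by exact_mod_cast hk
  set d : Fin n → ℝ := fun j => if j ∈ I then 1 else 0 with hd
  have hM := diagonal_sub_gramOf_mem_kPSDClosure d X hJ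
  set M := (72 * k : ℝ) • Matrix.diagonal d - gramOf X with hMdef
  set F := ‖gramOf X‖ ^ 2 with hF
  have hdiag : ∀ i, gramOf X i i = k * d i := fun i => by
    by_cases hi : i ∈ I
    · simp [gramOf, ← pow_two, hX1 i hi, hd, hi]
    · simp [gramOf, hX0 i hi, hd, hi]
  have hdsum : ∑ i, d i = 93 * k := by
    simp [hd, hI]
  have hd2 : ∀ i, d i * d i = d i := fun i => by simp [hd]
  have htr : ∑ i, gramOf X i i = 93 * (k : ℝ) ^ 2 := by
    simp only [hdiag, ← mul_sum, hdsum]; ring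
  have hFlb : 8649 * (k : ℝ) ^ 3 ≤ F := by
    have h := sq_sum_le_card_mul_gramOf X
    rw [htr, ← hF] at h
    refine le_of_mul_le_mul_left ?_ hk'
    linarith
  have hinner : ∀ N : Matrix (Fin n) (Fin n) ℝ,
      ∑ i, ∑ j, M i j * N i j = 72 * k * ∑ i, d i * N i i - ∑ i, ∑ j, gramOf X i j * N i j := by
    intro N
    simp only [hMdef, Matrix.sub_apply, Matrix.smul_apply, smul_eq_mul, sub_mul, sum_sub_distrib,
      Matrix.diagonal_apply, mul_ite, ite_mul, mul_zero, zero_mul, sum_ite_eq, mem_univ, if_true,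
      mul_sum, mul_assoc]
  have hGG : ∑ i, ∑ j, gramOf X i j * gramOf X i j = F := by
    rw [hF, frobenius_norm_sq]; simp only [pow_two]
  have hdG : ∑ i, d i * gramOf X i i = 93 * (k : ℝ) ^ 2 := by
    rw [← htr]
    refine sum_congr rfl fun i _ => ?_
    rw [hdiag, mul_left_comm, hd2]
  have hMG : ∑ i, ∑ j, M i j * gramOf X i j = 6696 * (k : ℝ) ^ 3 - F := by
    rw [hinner, hGG, hdG]; ring
  have hMM : ‖M‖ ^ 2 = F + 468720 * (k : ℝ) ^ 3 := by
    have h1 : ∑ i, d i * M i i = 72 * k * (93 * k) - 93 * (k : ℝ) ^ 2 := by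
      rw [← hdG, ← hdsum, mul_sum, ← sum_sub_distrib]
      refine sum_congr rfl fun i _ => ?_
      simp only [hMdef, Matrix.sub_apply, Matrix.smul_apply, smul_eq_mul, Matrix.diagonal_apply_eq]
      linear_combination 72 * (k : ℝ) * hd2 i
    have h2 : ∑ i, ∑ j, gramOf X i j * M i j = 6696 * (k : ℝ) ^ 3 - F := by
      rw [← hMG]
      exact sum_congr rfl fun i _ => sum_congr rfl fun j _ => mul_comm _ _
    rw [frobenius_norm_sq]
    simp only [pow_two]
    rw [hinner, h1, h2]
    ring
  have hk3 : (0 : ℝ) < (k : ℝ) ^ 3 := by positivity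
  have hF0 : 0 < F := by linarith
  have hG : 0 < ‖gramOf X‖ := by
    refine (norm_nonneg _).lt_of_ne fun h => ?_
    rw [hF, ← h] at hF0
    norm_num at hF0
  have hMpos : 0 < ‖M‖ := by
    refine (norm_nonneg _).lt_of_ne fun h => ?_
    rw [← h] at hMM
    norm_num at hMM
    linarith
  refine le_trans ?_ (div_le_normalizedDist hM hMpos X hG)
  rw [hMG, neg_sub]
  refine Real.sqrt_le_iff.2 ⟨div_nonneg (by linarith) (by positivity), ?_⟩
  rw [div_pow, mul_pow, hMM, ← hF, div_le_div_iff₀ (by norm_num) (by positivity)]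
  -- In terms of `t` and `k ^ 3`, the difference of the two sides has only positive coefficients.
  obtain ⟨t, ht⟩ : ∃ t, F = 8649 * (k : ℝ) ^ 3 + t := ⟨F - 8649 * (k : ℝ) ^ 3, by ring⟩
  have ht0 : 0 ≤ t := by linarith
  rw [ht]
  nlinarith [mul_nonneg ht0 hk3.le, mul_pos hk3 hk3, mul_nonneg ht0 ht0]

theorem theorem4 (r : ℝ) (hr : r < 1 / 93) (n k : ℕ) (hk : 2 ≤ k) (hkn : (k : ℝ) = r * (n : ℝ)) :
    √(r - 93 * r ^ 2) / √(162 * r + 3) < normalizedDist n k := by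
  have hk' : (0 : ℝ) < k := by exact_mod_cast (by omega : 0 < k)
  have hn : (0 : ℝ) ≤ n := Nat.cast_nonneg n
  have hr0 : 0 < r := by
    by_contra h
    nlinarith [mul_nonneg (sub_nonneg.2 (not_lt.1 h)) hn]
  have hle : 93 * k ≤ n := by
    have : 93 * (k : ℝ) ≤ n := by
      rw [hkn]; nlinarith
    exact_mod_cast this
  refine lt_of_lt_of_le ?_ (sqrt_le_normalizedDist (by omega) hle)
  rw [← Real.sqrt_div' _ (by positivity)]
  refine Real.sqrt_lt_sqrt (div_nonneg (by nlinarith) (by positivity)) ?_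
  rw [div_lt_div_iff₀ (by positivity) (by norm_num)]
  -- `r - 93r²` peaks at `r = 1/186` with value `1/372`, while `162r + 3 > 3`.
  nlinarith [sq_nonneg (r - 1 / 186)]
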